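/- Let $K$ be a field and let $S\subseteq\mathbb N^2$ be an affine semigroup, i.e. a finitely generated submonoid of $\mathbb N^2=\{0,1,2,\dots\}^2$, of dimension $2$ (it spans $\mathbb R^2$). Let $R=K[S]$ be the $K$-subalgebra of $K[x_1,x_2]$ generated by the monomials $x_1^{a}x_2^{b}$ with $(a,b)\in S$. Let $\operatorname{cone}(S)\subseteq\mathbb R^2$ be the cone of nonnegative real combinations of elements of $S$; it has exactly two extremal rays (one-dimensional faces). Let $\mathbf a_1=(c_1,d_1)$ and $\mathbf a_2=(c_2,d_2)$ be the extremal rays of $S$, i.e. the (componentwise) smallest nonzero elements of $S$ on each of the two extremal rays of $\operatorname{cone}(S)$, and put $E=\{\mathbf a_1,\mathbf a_2\}$. Let $$\operatorname{Ap}(S,E)=\{\mathbf a\in S : \mathbf a-\mathbf a_i\notin S \text{ for } i=1,2\},\qquad \operatorname{Gr}(S)=\{\mathbf a-\mathbf b : \mathbf a,\mathbf b\in S\}\subseteq\mathbb Z^2,$$ $$P_S=\{\mathbf z\in\mathbb N^2 : \mathbf z=\lambda_1\mathbf a_1+\lambda_2\mathbf a_2 \text{ for some real } 0\le\lambda_1,\lambda_2<1\}.$$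 Then the ring $R$ is Cohen–Macaulay if and only if $$|\operatorname{Ap}(S,E)|+|P_S\setminus\operatorname{Gr}(S)|=|c_1d_2-c_2d_1|.$$ -/

import Mathlib

noncomputable section

/-- The depth of a local ring `A`: the supremum of the lengths of the regular sequences
contained in its maximal ideal. -/
def localDepth (A : Type*) [CommRing A] [IsLocalRing A] : ℕ∞ :=
  ⨆ rs ∈ {rs : List A | (∀ r ∈ rs, r ∈ IsLocalRing.maximalIdeal A) ∧
    RingTheory.Sequence.IsRegular A rs}, (rs.length : ℕ∞)

/-- A commutative ring is Cohen–Macaulay if it is Noetherian and each of its localizations at a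
maximal ideal has depth equal to its Krull dimension. -/
structure IsCohenMacaulayRing (A : Type*) [CommRing A] : Prop where
  isNoetherianRing : IsNoetherianRing A
  depth_eq_dim : ∀ (m : Ideal A) [m.IsMaximal],
    (localDepth (Localization.AtPrime m) : WithBot ℕ∞) = ringKrullDim (Localization.AtPrime m)

namespace PlaneSemigroup

/-- The inclusion of `ℕ²` into `ℝ²`. -/
def toReal (a : ℕ × ℕ) : ℝ × ℝ := ((a.1 : ℝ), (a.2 : ℝ))

/-- The inclusion of `ℕ²` into `ℤ²`. -/
def toInt (a : ℕ × ℕ) : ℤ × ℤ := ((a.1 : ℤ), (a.2 : ℤ))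

/-- The semigroup ring `K[S]`: the `K`-subalgebra of the polynomial ring in two variables generated
by the monomials with exponents in `S`. -/
def semigroupRing (K : Type*) [Field K] (S : AddSubmonoid (ℕ × ℕ)) :
    Subalgebra K (MvPolynomial (Fin 2) K) :=
  Algebra.adjoin K
    ((fun a : ℕ × ℕ => (MvPolynomial.X 0 ^ a.1 * MvPolynomial.X 1 ^ a.2 :
      MvPolynomial (Fin 2) K)) '' (S : Set (ℕ × ℕ)))

/-- The cone in `ℝ²` of all nonnegative real combinations of elements of `S`. -/
def cone (S : AddSubmonoid (ℕ × ℕ)) : PointedCone ℝ (ℝ × ℝ) :=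
  PointedCone.hull ℝ (toReal '' (S : Set (ℕ × ℕ)))

/-- `a` is an extremal ray of `S`: the half-line spanned by `a` is a one-dimensional face of
`cone S`, and `a` is the (componentwise) smallest nonzero element of `S` on this half-line. -/
structure IsExtremalRay (S : AddSubmonoid (ℕ × ℕ)) (a : ℕ × ℕ) : Prop where
  mem : a ∈ S
  ne_zero : a ≠ 0
  isFaceOf : (PointedCone.hull ℝ {toReal a}).IsFaceOf (cone S)
  le_of_mem : ∀ b ∈ S, b ≠ 0 → toReal b ∈ PointedCone.hull ℝ {toReal a} → a ≤ b

/-- The Apéry set of `S` with respect to `E`: the `a ∈ S` with `a - e ∉ S` for all `e ∈ E`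
(the difference being taken in `ℤ²`). -/
def aperySet (S : AddSubmonoid (ℕ × ℕ)) (E : Set (ℕ × ℕ)) : Set (ℕ × ℕ) :=
  {a | a ∈ S ∧ ∀ e ∈ E, toInt a - toInt e ∉ toInt '' (S : Set (ℕ × ℕ))}

/-- The group of differences of `S`, as a subset of `ℤ²`. -/
def groupOfDifferences (S : AddSubmonoid (ℕ × ℕ)) : Set (ℤ × ℤ) :=
  {z | ∃ a ∈ S, ∃ b ∈ S, z = toInt a - toInt b}

/-- The lattice points of the half-open parallelogram spanned by `a₁` and `a₂`. -/
def parallelogram (a₁ a₂ : ℕ × ℕ) : Set (ℕ × ℕ) :=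
  {z | ∃ l₁ l₂ : ℝ, (0 ≤ l₁ ∧ l₁ < 1) ∧ (0 ≤ l₂ ∧ l₂ < 1) ∧
    toReal z = l₁ • toReal a₁ + l₂ • toReal a₂}

end PlaneSemigroup

end

/-! Both sides are equivalent to `RegularPair a₁ a₂`: whenever `a + a₁ = b + a₂`, the vector `a₂`
can be subtracted from `a` inside `S`.

Algebra. Every element of `S` is an Apéry element plus multiples of `a₁` and `a₂`, and `RegularPair`
says that this decomposition is unique. Then `K[S]` is free over the polynomial ring in `X^a₁`,
`X^a₂`, with the Apéry monomials as basis (`SimplicialWeights.free`), and it is integral over that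
ring, so it is Cohen–Macaulay. Conversely, localize a Cohen–Macaulay `K[S]` at the origin, where the
depth is at least 2. If `a + a₁ = b + a₂`, the ideal `(X^a₂ : X^a)` is primary to the origin or the
unit ideal, and depth 2 excludes the former; hence `X^a₂` divides `X^a`
(`SimplicialWeights.regularPair_of_isCohenMacaulayRing`).

Counting. Let `G` be the quotient of `ℤ²` by the lattice spanned by `a₁`, `a₂`, of order `|c₁d₂ -
c₂d₁|`. The parallelogram represents each class once, and the classes met by `Gr(S)` are those of
Apéry elements. So the numerical equality says that the Apéry set injects into `G`, which is again
`RegularPair` (`encard_add_encard_eq_iff`). -/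

/-- Numerical data exhibiting a commutative monoid as simplicial of rank two over `a₁`, `a₂`: up to
a common denominator `N`, the homomorphisms `u` and `v` are the coordinates with respect to
`a₁` and `a₂`. -/
structure SimplicialWeights {M : Type*} [AddCommMonoid M] (a₁ a₂ : M) where
  N : ℕ
  u : M →+ ℕ
  v : M →+ ℕ
  N_pos : 0 < N
  u_left : u a₁ = N
  u_right : u a₂ = 0
  v_left : v a₁ = 0
  v_right : v a₂ = N
  nsmul_eq : ∀ s, N • s = u s • a₁ + v s • a₂
  eq_zero : ∀ s, u s = 0 → v s = 0 → s = 0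

/-- The monomials with exponents `a₂`, `a₁` form a regular sequence, in terms of exponents. -/
def RegularPair {M : Type*} [AddCommMonoid M] (a₁ a₂ : M) : Prop :=
  ∀ a b : M, a + a₁ = b + a₂ → ∃ c, a = c + a₂

/-- The elements of a commutative monoid from which neither `a₁` nor `a₂` can be subtracted. -/
def aperyElements {M : Type*} [AddCommMonoid M] (a₁ a₂ : M) : Set M :=
  {w | (∀ c, w ≠ c + a₁) ∧ ∀ c, w ≠ c + a₂}

/-! ### Apéry decompositions in a cancellative monoid -/

section Monoid

variable {M : Type*} [AddCommMonoid M] {a₁ a₂ : M}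

theorem aperyElements_comm (a₁ a₂ : M) : aperyElements a₁ a₂ = aperyElements a₂ a₁ := by
  ext; simp [aperyElements, and_comm]

theorem SimplicialWeights.exists_decomposition (D : SimplicialWeights a₁ a₂) (s : M) :
    -- Subtracting `a₁` or `a₂` lowers `u + v` by `N > 0`, so the process stops.
    ∃ w ∈ aperyElements a₁ a₂, ∃ i j : ℕ, s = w + i • a₁ + j • a₂ := by
  induction hn : D.u s + D.v s using Nat.strong_induction_on generalizing s with
  | _ n ih =>
    have hN := D.N_pos
    by_cases h1 : ∃ c, s = c + a₁
    · obtain ⟨c, rfl⟩ := h1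
      obtain ⟨w, hw, i, j, rfl⟩ := ih _ (by
        rw [← hn, map_add, map_add, D.u_left, D.v_left]; omega) c rfl
      exact ⟨w, hw, i + 1, j, by rw [succ_nsmul]; abel⟩
    by_cases h2 : ∃ c, s = c + a₂
    · obtain ⟨c, rfl⟩ := h2
      obtain ⟨w, hw, i, j, rfl⟩ := ih _ (by
        rw [← hn, map_add, map_add, D.u_right, D.v_right]; omega) c rfl
      exact ⟨w, hw, i, j + 1, by rw [succ_nsmul]; abel⟩
    push Not at h1 h2
    exact ⟨s, ⟨h1, h2⟩, 0, 0, by simp⟩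

variable [IsCancelAdd M]

theorem RegularPair.symm (h : RegularPair a₁ a₂) : RegularPair a₂ a₁ := by
  intro a b hab
  obtain ⟨c, rfl⟩ := h b a hab.symm
  refine ⟨c, add_right_cancel (b := a₂) ?_⟩
  rw [hab]; abel

theorem RegularPair.exists_of_nsmul (h : RegularPair a₁ a₂) (p q : ℕ) :
    ∀ a b : M, a + p • a₂ = b + (q + 1) • a₁ → ∃ c, a = c + a₁ := by
  induction p generalizing q with
  | zero =>
    intro a b hab
    exact ⟨b + q • a₁, by simpa [add_nsmul, add_assoc] using hab⟩
  | succ p ih =>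
    intro a b hab
    obtain ⟨c, hc⟩ := h (b + q • a₁) (a + p • a₂) (by
      simpa [add_nsmul, add_assoc] using hab.symm)
    refine ih 0 a c (add_right_cancel (b := a₂) ?_)
    calc a + p • a₂ + a₂ = a + (p + 1) • a₂ := by rw [succ_nsmul, add_assoc]
      _ = b + q • a₁ + a₁ := by rw [hab, succ_nsmul, add_assoc]
      _ = _ := by rw [hc]; simp only [zero_add, one_nsmul]; abel

/-- If `i < i'`, cancellation leaves a surplus of `a₁` on the right, and regularity moves it past
any multiple of `a₂` into `w`, which admits no subtraction of `a₁`. -/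
theorem RegularPair.index_le (h : RegularPair a₁ a₂) {w w' : M} (hw : w ∈ aperyElements a₁ a₂)
    {i j i' j' : ℕ} (e : w + i • a₁ + j • a₂ = w' + i' • a₁ + j' • a₂) : i' ≤ i := by
  by_contra! hi
  obtain ⟨d, rfl⟩ := Nat.exists_eq_add_of_lt hi
  have e' : w + j • a₂ = w' + (d + 1) • a₁ + j' • a₂ := by
    apply add_left_cancel (a := i • a₁)
    calc _ = w + i • a₁ + j • a₂ := by abel
      _ = _ := by rw [e, add_assoc i, add_nsmul]; abel
  rcases le_total j j' with hj | hj
  · obtain ⟨k, rfl⟩ := Nat.exists_eq_add_of_le hj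
    refine hw.1 (w' + d • a₁ + k • a₂) (add_right_cancel (b := j • a₂) ?_)
    rw [e', add_nsmul, add_nsmul, one_nsmul]; abel
  · obtain ⟨k, rfl⟩ := Nat.exists_eq_add_of_le hj
    have e'' : w + k • a₂ = w' + (d + 1) • a₁ := by
      apply add_right_cancel (b := j' • a₂)
      rw [← e', add_nsmul]; abel
    obtain ⟨c, hc⟩ := h.exists_of_nsmul k d _ _ e''
    exact hw.1 c hc

theorem RegularPair.unique (h : RegularPair a₁ a₂) {w w' : M} (hw : w ∈ aperyElements a₁ a₂)
    (hw' : w' ∈ aperyElements a₁ a₂) {i j i' j' : ℕ}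
    (e : w + i • a₁ + j • a₂ = w' + i' • a₁ + j' • a₂) : w = w' ∧ i = i' ∧ j = j' := by
  have hi : i = i' := le_antisymm (h.index_le hw' e.symm) (h.index_le hw e)
  have e' : w + j • a₂ + i • a₁ = w' + j' • a₂ + i' • a₁ := by
    rw [add_right_comm, e, add_right_comm]
  have hj : j = j' := le_antisymm (h.symm.index_le (aperyElements_comm a₁ a₂ ▸ hw') e'.symm)
    (h.symm.index_le (aperyElements_comm a₁ a₂ ▸ hw) e')
  subst hi hj
  exact ⟨add_right_cancel (add_right_cancel e), rfl, rfl⟩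

theorem SimplicialWeights.regularPair_iff (D : SimplicialWeights a₁ a₂) :
    RegularPair a₁ a₂ ↔ ∀ w ∈ aperyElements a₁ a₂, ∀ w' ∈ aperyElements a₁ a₂,
      ∀ i j i' j' : ℕ, w + i • a₁ + j • a₂ = w' + i' • a₁ + j' • a₂ → w = w' := by
  refine ⟨fun h w hw w' hw' i j i' j' e => (h.unique hw hw' e).1, fun h a b hab => ?_⟩
  obtain ⟨w, hw, i, j, rfl⟩ := D.exists_decomposition a
  obtain ⟨w', hw', i', j', rfl⟩ := D.exists_decomposition b
  have e : w + (i + 1) • a₁ + j • a₂ = w' + i' • a₁ + (j' + 1) • a₂ := by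
    rw [succ_nsmul, succ_nsmul]
    calc _ = w + i • a₁ + j • a₂ + a₁ := by abel
      _ = _ := by rw [hab]; abel
  obtain rfl := h w hw w' hw' _ _ _ _ e
  -- With equal Apéry parts, the weight `v` gives `j = j' + 1`, so `a` contains a copy of `a₂`.
  have hv := congrArg D.v e
  simp only [map_add, map_nsmul, D.v_left, D.v_right, smul_eq_mul, mul_zero, add_zero,
    add_right_inj] at hv
  have hj : j = j' + 1 := Nat.eq_of_mul_eq_mul_right D.N_pos (by omega)
  exact ⟨w + i • a₁ + j' • a₂, by rw [hj, succ_nsmul]; abel⟩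

end Monoid

/-! ### Invariance of depth and Cohen–Macaulayness under isomorphism -/

open RingTheory.Sequence in
theorem isRegular_map_ringEquiv {A B : Type*} [CommRing A] [CommRing B] (e : A ≃+* B)
    {rs : List A} (h : IsRegular A rs) : IsRegular B (rs.map e) := by
  refine (AddEquiv.isRegular_congr (e := e.toAddEquiv) (as := rs) (bs := rs.map e) ?_).1 h
  rw [List.forall₂_map_right_iff, List.forall₂_same]
  intro r _ x
  simp

theorem localDepth_le_of_ringEquiv {A B : Type*} [CommRing A] [IsLocalRing A] [CommRing B]
    [IsLocalRing B] (e : A ≃+* B) : localDepth A ≤ localDepth B := by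
  refine iSup₂_le fun rs hrs => ?_
  refine le_trans (le_of_eq (by simp)) (le_iSup₂ (f := fun (rs : List B) _ => (rs.length : ℕ∞))
    (rs.map e) ⟨?_, isRegular_map_ringEquiv e hrs.2⟩)
  intro r hr
  obtain ⟨x, hx, rfl⟩ := List.mem_map.1 hr
  simpa [IsLocalRing.mem_maximalIdeal, mem_nonunits_iff] using hrs.1 x hx

theorem IsCohenMacaulayRing.of_ringEquiv {A B : Type*} [CommRing A] [CommRing B] (e : A ≃+* B)
    (h : IsCohenMacaulayRing A) : IsCohenMacaulayRing B where
  isNoetherianRing := have := h.isNoetherianRing; isNoetherianRing_of_ringEquiv A e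
  depth_eq_dim m hm := by
    have hmax : (m.comap e.toRingHom).IsMaximal :=
      Ideal.comap_isMaximal_of_surjective _ e.surjective
    have e' : Localization.AtPrime (m.comap e.toRingHom) ≃+* Localization.AtPrime m :=
      IsLocalization.ringEquivOfRingEquiv (M := (m.comap e.toRingHom).primeCompl)
        (T := m.primeCompl) _ _ e (by
          ext x
          simp only [Submonoid.mem_map, Ideal.mem_primeCompl_iff, Ideal.mem_comap]
          exact ⟨by rintro ⟨y, hy, rfl⟩; exact hy, fun hx => ⟨e.symm x, by simpa using hx, by simp⟩⟩)
    rw [← ringKrullDim_eq_of_ringEquiv e', ← h.depth_eq_dim (m.comap e.toRingHom)]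
    exact congrArg _ (le_antisymm (localDepth_le_of_ringEquiv e'.symm)
      (localDepth_le_of_ringEquiv e'))

/-! ### A regular pair makes the monoid algebra Cohen–Macaulay -/

open Polynomial in
/-- The homomorphism `K[X][Y] → K[M]` sending `X`, `Y` to the monomials with exponents
`a₁`, `a₂`. -/
noncomputable def parameterHom (K : Type*) [Field K] {M : Type*} [AddCommMonoid M] (a₁ a₂ : M) :
    K[X][X] →+* AddMonoidAlgebra K M :=
  eval₂RingHom (aeval (AddMonoidAlgebra.single a₁ 1) : K[X] →ₐ[K] AddMonoidAlgebra K M).toRingHom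
    (AddMonoidAlgebra.single a₂ 1)

/-- Incomparability: contraction of primes along an integral extension is strictly monotone. -/
theorem ringKrullDim_le_of_isIntegral (A B : Type*) [CommRing A] [CommRing B] [Algebra A B]
    [Algebra.IsIntegral A B] : ringKrullDim B ≤ ringKrullDim A :=
  Order.krullDim_le_of_strictMono (PrimeSpectrum.comap (algebraMap A B)) fun _ _ h =>
    Ideal.IsIntegral.comap_lt_comap h

open RingTheory.Sequence in
theorem isWeaklyRegular_pair {R : Type*} [CommRing R] {f g : R} (hf : IsSMulRegular R f)
    (h : ∀ x y, g * x = f * y → f ∣ x) : IsWeaklyRegular R [f, g] := by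
  rw [isWeaklyRegular_cons_iff, isWeaklyRegular_singleton_iff]
  refine ⟨hf, (isSMulRegular_quotient_iff_mem_of_smul_mem _ _).2 fun x hx => ?_⟩
  obtain ⟨y, -, hy⟩ := (Submodule.mem_smul_pointwise_iff_exists _ _ _).1 hx
  obtain ⟨z, rfl⟩ := h x y (by simpa using hy.symm)
  exact (Submodule.mem_smul_pointwise_iff_exists _ _ _).2 ⟨z, trivial, rfl⟩

-- Modulo `f(X)`, the polynomial `g(Y)` is still monic in `Y`, hence not a zero divisor.
open Polynomial RingTheory.Sequence in
theorem Polynomial.isWeaklyRegular_C_map {K : Type*} [Field K] {f g : K[X]} (hf : f.Monic)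
    (hg : g.Monic) : IsWeaklyRegular K[X][X] [C f, g.map C] := by
  refine isWeaklyRegular_pair (IsSMulRegular.of_ne_zero (C_ne_zero.2 hf.ne_zero))
    fun x y hxy => ?_
  rw [C_dvd_iff_dvd_coeff]
  have h0 : (g.map C).map (Ideal.Quotient.mk (Ideal.span {f})) *
      x.map (Ideal.Quotient.mk (Ideal.span {f})) = 0 := by
    rw [← Polynomial.map_mul, hxy, Polynomial.map_mul, map_C,
      Ideal.Quotient.eq_zero_iff_mem.2 (Ideal.mem_span_singleton_self f), C_0, zero_mul]
  rw [((hg.map C).map _).mul_right_eq_zero_iff] at h0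
  intro i
  rw [← Ideal.mem_span_singleton, ← Ideal.Quotient.eq_zero_iff_mem, ← coeff_map, h0, coeff_zero]

section

open Polynomial

variable {K : Type*} [Field K] {M : Type*} [AddCommMonoid M] {a₁ a₂ : M}

theorem parameterHom_monomial (i j : ℕ) (c : K) :
    parameterHom K a₁ a₂ (monomial j (monomial i c)) =
      AddMonoidAlgebra.single (i • a₁ + j • a₂) c := by
  simp [parameterHom, aeval_monomial, AddMonoidAlgebra.single_pow,
    AddMonoidAlgebra.single_mul_single]

theorem SimplicialWeights.isIntegral (D : SimplicialWeights a₁ a₂) :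
    letI := (parameterHom K a₁ a₂).toAlgebra
    Algebra.IsIntegral K[X][X] (AddMonoidAlgebra K M) := by
  let := (parameterHom K a₁ a₂).toAlgebra
  refine ⟨fun x => ?_⟩
  induction x using AddMonoidAlgebra.induction_linear with
  | zero => exact isIntegral_zero
  | add x y hx hy => exact hx.add hy
  | single s c =>
    refine IsIntegral.of_pow D.N_pos ?_
    rw [AddMonoidAlgebra.single_pow, D.nsmul_eq, ← parameterHom_monomial]
    exact isIntegral_algebraMap (R := K[X][X]) (A := AddMonoidAlgebra K M)

/-- By the Nullstellensatz the residue field at `m` is finite over `K`. This supplies parameters at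
every maximal ideal, not only at the origin. -/
theorem exists_monic_aeval_mem {R : Type*} [CommRing R] [Algebra K R] [Algebra.FiniteType K R]
    (m : Ideal R) [m.IsMaximal] (x : R) : ∃ f : K[X], f.Monic ∧ aeval x f ∈ m := by
  let := Ideal.Quotient.field m
  have : Algebra.FiniteType K (R ⧸ m) :=
    Algebra.FiniteType.of_surjective (Ideal.Quotient.mkₐ K m) (Ideal.Quotient.mkₐ_surjective K m)
  have := finite_of_finite_type_of_isJacobsonRing K (R ⧸ m)
  obtain ⟨f, hf, hx⟩ := Algebra.IsIntegral.isIntegral (R := K) (Ideal.Quotient.mkₐ K m x)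
  refine ⟨f, hf, Ideal.Quotient.eq_zero_iff_mem.1 ?_⟩
  rw [← aeval_def, aeval_algHom_apply] at hx
  exact hx

variable [IsCancelAdd M]

-- Unique decomposition lets one coefficient of the product read off one coefficient of `p`; this
-- gives linear independence of the Apéry monomials.
open Classical in
theorem RegularPair.coeff_parameterHom_mul (h : RegularPair a₁ a₂) (p : K[X][X]) {w w' : M}
    (hw : w ∈ aperyElements a₁ a₂) (hw' : w' ∈ aperyElements a₁ a₂) (i j : ℕ) :
    (parameterHom K a₁ a₂ p * AddMonoidAlgebra.single w 1).coeff (w' + i • a₁ + j • a₂) =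
      if w = w' then (p.coeff j).coeff i else 0 := by
  induction p using Polynomial.induction_on' with
  | add p q hp hq => simp only [map_add, add_mul, AddMonoidAlgebra.coeff_add, Finsupp.add_apply,
      hp, hq, coeff_add]; split_ifs <;> simp
  | monomial n p =>
    induction p using Polynomial.induction_on' with
    | add p q hp hq => simp only [map_add, add_mul, AddMonoidAlgebra.coeff_add, Finsupp.add_apply,
        hp, hq, coeff_add]; split_ifs <;> simp
    | monomial m c =>
      rw [parameterHom_monomial, AddMonoidAlgebra.single_mul_single, mul_one,
        AddMonoidAlgebra.coeff_single, Finsupp.single_apply]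
      have key : m • a₁ + n • a₂ + w = w' + i • a₁ + j • a₂ ↔ w = w' ∧ m = i ∧ n = j := by
        constructor
        · intro e
          exact h.unique hw hw' (by rw [← e]; abel)
        · rintro ⟨rfl, rfl, rfl⟩; abel
      simp only [key, coeff_monomial]
      by_cases h1 : w = w' <;> by_cases h2 : m = i <;> by_cases h3 : n = j <;>
        simp [h1, h2, h3, coeff_monomial]

theorem SimplicialWeights.free (D : SimplicialWeights a₁ a₂) (h : RegularPair a₁ a₂) :
    letI := (parameterHom K a₁ a₂).toAlgebra
    Module.Free K[X][X] (AddMonoidAlgebra K M) := by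
  let := (parameterHom K a₁ a₂).toAlgebra
  have smul_def (p : K[X][X]) (x : AddMonoidAlgebra K M) :
    p • x = parameterHom K a₁ a₂ p * x := rfl
  refine Module.Free.of_basis (Module.Basis.mk
    (v := fun w : aperyElements a₁ a₂ => AddMonoidAlgebra.single (w : M) (1 : K)) ?_ ?_)
  · rw [linearIndependent_iff]
    intro l hl
    ext w j i
    have := congrArg (fun x => x.coeff ((w : M) + i • a₁ + j • a₂)) hl
    classical
    simp only [Finsupp.linearCombination_apply, Finsupp.sum, smul_def,
      AddMonoidAlgebra.coeff_sum, Finsupp.finsetSum_apply,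
      h.coeff_parameterHom_mul _ (Subtype.property _) w.2] at this
    by_cases hz : l w = 0
    · simp [hz]
    · simpa [← Subtype.ext_iff, hz] using this
  · intro x _
    induction x using AddMonoidAlgebra.induction_linear with
    | zero => exact zero_mem _
    | add x y hx hy => exact add_mem (hx trivial) (hy trivial)
    | single s c =>
      obtain ⟨w, hw, i, j, rfl⟩ := D.exists_decomposition s
      have : AddMonoidAlgebra.single (w + i • a₁ + j • a₂) c =
          (monomial j (monomial i c) : K[X][X]) • AddMonoidAlgebra.single w (1 : K) := by
        rw [smul_def, parameterHom_monomial, AddMonoidAlgebra.single_mul_single, mul_one]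
        congr 1; abel
      rw [this]
      exact Submodule.smul_mem _ _ (Submodule.subset_span ⟨⟨w, hw⟩, rfl⟩)

theorem SimplicialWeights.isCohenMacaulayRing (D : SimplicialWeights a₁ a₂) [AddMonoid.FG M]
    (h : RegularPair a₁ a₂) : IsCohenMacaulayRing (AddMonoidAlgebra K M) := by
  have hN : IsNoetherianRing (AddMonoidAlgebra K M) := Algebra.FiniteType.isNoetherianRing K _
  refine ⟨hN, fun m hm => ?_⟩
  let := (parameterHom K a₁ a₂).toAlgebra
  have := D.free (K := K) h
  have := D.isIntegral (K := K)
  have hdim : ringKrullDim (Localization.AtPrime m) ≤ 2 := by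
    rw [IsLocalization.AtPrime.ringKrullDim_eq_height m]
    refine (Ideal.height_le_ringKrullDim_of_ne_top hm.ne_top).trans
      ((ringKrullDim_le_of_isIntegral K[X][X] _).trans ?_)
    rw [Polynomial.ringKrullDim_of_isNoetherianRing, Polynomial.ringKrullDim_of_isNoetherianRing,
      ringKrullDim_eq_zero_of_field]
    norm_num
  -- Each regular sequence lowers the dimension by its length, and the quotient is nonzero, so of
  -- dimension at least 0.
  have hle : (localDepth (Localization.AtPrime m) : WithBot ℕ∞) ≤
      ringKrullDim (Localization.AtPrime m) := by
    obtain ⟨d, hd⟩ : ∃ d : ℕ∞, ringKrullDim (Localization.AtPrime m) = d :=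
      ⟨_, IsLocalization.AtPrime.ringKrullDim_eq_height m _⟩
    rw [hd, WithBot.coe_le_coe]
    refine iSup₂_le fun rs hrs => ?_
    have : Nontrivial (Localization.AtPrime m ⧸ Ideal.ofList rs) :=
      Ideal.Quotient.nontrivial_iff.2 fun h => hrs.2.2 (by simp [h])
    rw [← WithBot.coe_le_coe, ← hd,
      ← ringKrullDim_add_length_eq_ringKrullDim_of_isRegular rs hrs.2]
    exact le_add_of_nonneg_left ringKrullDim_nonneg_of_nontrivial
  refine le_antisymm hle (hdim.trans ?_)
  obtain ⟨f, hf, hfm⟩ := exists_monic_aeval_mem (K := K) m (AddMonoidAlgebra.single a₁ 1)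
  obtain ⟨g, hg, hgm⟩ := exists_monic_aeval_mem (K := K) m (AddMonoidAlgebra.single a₂ 1)
  -- Freeness gives flatness, which carries the regular sequence `f(X)`, `g(Y)` up to `K[M]`; both
  -- members lie in `m`.
  have hreg := (Polynomial.isWeaklyRegular_C_map hf hg).of_flat (S := AddMonoidAlgebra K M)
  have hreg' := hreg.isRegular_of_isLocalization_of_mem (Localization.AtPrime m) m (by
    have hf' : algebraMap K[X][X] (AddMonoidAlgebra K M) (C f) ∈ m := by
      change parameterHom K a₁ a₂ (C f) ∈ m
      simpa [parameterHom] using hfm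
    have hg' : algebraMap K[X][X] (AddMonoidAlgebra K M) (g.map C) ∈ m := by
      change parameterHom K a₁ a₂ (g.map C) ∈ m
      convert hgm
      simp only [parameterHom, coe_eval₂RingHom, eval₂_map, aeval_def]
      congr 1
      ext c : 1
      simp
    simp [hf', hg'])
  rw [show (2 : WithBot ℕ∞) = ((2 : ℕ∞) : WithBot ℕ∞) from rfl, WithBot.coe_le_coe]
  refine le_iSup₂_of_le _ ⟨?_, hreg'⟩ (by simp)
  intro r hr
  -- A member outside the maximal ideal would be a unit, and the sequence would generate the whole
  -- ring.
  by_contra hrm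
  refine hreg'.2 ?_
  rw [Ideal.eq_top_of_isUnit_mem (Ideal.ofList _) (Ideal.subset_span hr) (by simpa using hrm)]
  simp

end

/-! ### A Cohen–Macaulay monoid algebra gives a regular pair -/

/-- A Hartogs-type extension: the fraction `x / y` has a power of `f` and a power of `g` as
denominators, and for a regular pair `f`, `g` it then lies in `B`. Each induction step removes one
factor `f`. -/
theorem dvd_of_dvd_pow_mul {B : Type*} [CommRing B] [IsDomain B] {f g x y : B} (hf : f ≠ 0)
    (hg : ∀ z, f ∣ g * z → f ∣ z) (hy : y ≠ 0) (p q : ℕ) (hp : y ∣ f ^ p * x)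
    (hq : y ∣ g ^ q * x) : y ∣ x := by
  have hgq : ∀ z, f ∣ g ^ q * z → f ∣ z := by
    clear hq
    induction q with
    | zero => simp
    | succ q ih => exact fun z h => ih z (hg _ (by rwa [← mul_assoc, ← pow_succ']))
  induction p with
  | zero => simpa using hp
  | succ p ih =>
    obtain ⟨s, hs⟩ := hp
    obtain ⟨t, ht⟩ := hq
    obtain ⟨r, rfl⟩ := hgq s ⟨f ^ p * t, mul_left_cancel₀ hy (by
      linear_combination (-g ^ q) * hs + f ^ (p + 1) * ht)⟩
    exact ih ⟨r, mul_left_cancel₀ hf (by linear_combination hs)⟩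

section

variable {K : Type*} [Field K] {M : Type*} [AddCommMonoid M] {a₁ a₂ : M}

/-- The homomorphism from a monoid algebra that restricts to the face on which the weight `w`
vanishes. -/
noncomputable def faceHom {B : Type*} [CommRing B] [Algebra K B] (w : M →+ ℕ)
    (g : Multiplicative M →* B) : AddMonoidAlgebra K M →ₐ[K] B :=
  AddMonoidAlgebra.lift K B M
    { toFun := fun s => if w s.toAdd = 0 then g s else 0
      map_one' := by simp
      map_mul' := by
        intro s t
        by_cases hs : w s.toAdd = 0 <;> by_cases ht : w t.toAdd = 0 <;> simp [hs, ht] }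

theorem faceHom_single {B : Type*} [CommRing B] [Algebra K B] (w : M →+ ℕ)
    (g : Multiplicative M →* B) (s : M) (c : K) :
    faceHom w g (AddMonoidAlgebra.single s c) =
      if w s = 0 then c • g (Multiplicative.ofAdd s) else 0 := by
  simp [faceHom]

variable (K) in
/-- The augmentation of a monoid algebra killing all monomials of positive weight. -/
noncomputable def SimplicialWeights.augmentation (D : SimplicialWeights a₁ a₂) :
    AddMonoidAlgebra K M →ₐ[K] K :=
  faceHom (D.u + D.v) 1

theorem SimplicialWeights.augmentation_single (D : SimplicialWeights a₁ a₂) (s : M) (c : K)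
    [Decidable (s = 0)] :
    D.augmentation K (AddMonoidAlgebra.single s c) = if s = 0 then c else 0 := by
  have : (D.u + D.v) s = 0 ↔ s = 0 := by
    constructor
    · intro h
      have h' : D.u s = 0 ∧ D.v s = 0 := by simpa using h
      exact D.eq_zero s h'.1 h'.2
    · rintro rfl; simp
  simp only [augmentation, faceHom_single, this, MonoidHom.one_apply, smul_eq_mul, mul_one]

theorem SimplicialWeights.augmentation_eq_coeff (D : SimplicialWeights a₁ a₂)
    (r : AddMonoidAlgebra K M) : D.augmentation K r = r.coeff 0 := by
  classical
  induction r using AddMonoidAlgebra.induction_linear with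
  | zero => simp
  | add x y hx hy => simp [hx, hy]
  | single s c => rw [D.augmentation_single, AddMonoidAlgebra.coeff_single, Finsupp.single_apply]

theorem SimplicialWeights.ker_augmentation_le (D : SimplicialWeights a₁ a₂)
    (J : Ideal (AddMonoidAlgebra K M)) (hJ : ∀ s ≠ 0, AddMonoidAlgebra.single s 1 ∈ J) :
    RingHom.ker (D.augmentation K) ≤ J := by
  intro r hr
  rw [RingHom.mem_ker, D.augmentation_eq_coeff] at hr
  rw [← AddMonoidAlgebra.sum_coeff_single r]
  refine sum_mem fun s hs => ?_
  have hs0 : s ≠ 0 := by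
    rintro rfl
    exact (Finsupp.mem_support_iff.1 hs) hr
  have : AddMonoidAlgebra.single s (r.coeff s) =
      AddMonoidAlgebra.single 0 (r.coeff s) * AddMonoidAlgebra.single s 1 := by
    rw [AddMonoidAlgebra.single_mul_single, zero_add, mul_one]
  rw [this]
  exact J.mul_mem_left _ (hJ s hs0)

instance SimplicialWeights.ker_augmentation_isMaximal (D : SimplicialWeights a₁ a₂) :
    (RingHom.ker (D.augmentation K)).IsMaximal :=
  RingHom.ker_isMaximal_of_surjective _ fun c => ⟨AddMonoidAlgebra.single 0 c, by
    classical simp [D.augmentation_single]⟩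

/-- The chain is zero, the prime of the face `u = 0`, the origin; `X^a₁` and `X^a₂` witness the two
strict inclusions. -/
theorem SimplicialWeights.two_le_height [IsDomain (AddMonoidAlgebra K M)]
    (D : SimplicialWeights a₁ a₂) : 2 ≤ (RingHom.ker (D.augmentation K)).height := by
  classical
  set face : AddMonoidAlgebra K M →ₐ[K] AddMonoidAlgebra K M :=
    faceHom D.u (AddMonoidAlgebra.of K M) with hface
  have hN := D.N_pos.ne'
  have hprime : (RingHom.ker face).IsPrime := RingHom.ker_isPrime face
  have h1 : ⊥ < RingHom.ker face := by
    refine bot_lt_iff_ne_bot.2 fun h => ?_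
    have hm : AddMonoidAlgebra.single a₁ (1 : K) ∈ RingHom.ker face := by
      rw [RingHom.mem_ker, hface, faceHom_single, D.u_left, if_neg hN]
    rw [h, Ideal.mem_bot, AddMonoidAlgebra.single_eq_zero] at hm
    exact one_ne_zero hm
  have hcomp : (D.augmentation K).comp face = D.augmentation K := by
    refine AlgHom.ext fun x => ?_
    induction x using AddMonoidAlgebra.induction_linear with
    | zero => simp
    | add x y hx hy => rw [map_add, map_add, hx, hy]
    | single s c =>
      rw [AlgHom.comp_apply, hface, faceHom_single]
      by_cases hs : D.u s = 0
      · simp [hs, D.augmentation_single]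
      · have : s ≠ 0 := fun h => hs (by rw [h, map_zero])
        simp [hs, D.augmentation_single, this]
  have h2 : RingHom.ker face < RingHom.ker (D.augmentation K) := by
    refine lt_of_le_of_ne (fun r hr => ?_) fun h => ?_
    · rw [RingHom.mem_ker] at hr ⊢
      rw [← hcomp, AlgHom.comp_apply, hr, map_zero]
    · have ha : a₂ ≠ 0 := fun h => hN (by rw [← D.v_right, congrArg D.v h, map_zero])
      have hm : AddMonoidAlgebra.single a₂ (1 : K) ∈ RingHom.ker (D.augmentation K) := by
        rw [RingHom.mem_ker, D.augmentation_single, if_neg ha]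
      rw [← h, RingHom.mem_ker, hface, faceHom_single, D.u_right, if_pos rfl] at hm
      simp at hm
  calc (2 : ℕ∞) = 0 + 1 + 1 := by norm_num
    _ ≤ (⊥ : Ideal (AddMonoidAlgebra K M)).height + 1 + 1 := by gcongr; simp
    _ ≤ (RingHom.ker face).height + 1 := by
      gcongr; exact Ideal.height_add_one_le_of_lt_of_isPrime h1
    _ ≤ _ := Ideal.height_add_one_le_of_lt_of_isPrime h2

open RingTheory.Sequence in
theorem exists_regular_pair_of_localDepth {B : Type*} [CommRing B] [IsLocalRing B] [IsDomain B]
    (h : 2 ≤ localDepth B) : ∃ f ∈ IsLocalRing.maximalIdeal B, ∃ g ∈ IsLocalRing.maximalIdeal B,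
      f ≠ 0 ∧ ∀ z, f ∣ g * z → f ∣ z := by
  have h1 : 1 < localDepth B := lt_of_lt_of_le (by norm_num) h
  simp only [localDepth, lt_iSup_iff] at h1
  obtain ⟨rs, hrs, hlen⟩ := h1
  match rs, hrs, hlen with
  | [], _, hlen => simp at hlen
  | [_], _, hlen => simp at hlen
  | f :: g :: tl, hrs, _ =>
    have hreg := hrs.2.toIsWeaklyRegular
    rw [isWeaklyRegular_cons_iff, isWeaklyRegular_cons_iff] at hreg
    refine ⟨f, hrs.1 f (by simp), g, hrs.1 g (by simp), ?_, fun z hz => ?_⟩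
    · rintro rfl
      exact one_ne_zero (hreg.1 (by simp : (0 : B) • (1 : B) = (0 : B) • 0))
    · obtain ⟨t, ht⟩ := hz
      have := (isSMulRegular_quotient_iff_mem_of_smul_mem _ _).1 hreg.2.1 z
        ((Submodule.mem_smul_pointwise_iff_exists _ _ _).2 ⟨t, trivial, ht.symm⟩)
      obtain ⟨y, -, hy⟩ := (Submodule.mem_smul_pointwise_iff_exists _ _ _).1 this
      exact ⟨y, hy.symm⟩

variable [IsCancelAdd M]

theorem SimplicialWeights.regularPair_of_isCohenMacaulayRing [IsDomain (AddMonoidAlgebra K M)]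
    (D : SimplicialWeights a₁ a₂) (h : IsCohenMacaulayRing (AddMonoidAlgebra K M)) :
    RegularPair a₁ a₂ := by
  classical
  intro a b hab
  set m := RingHom.ker (D.augmentation K) with hm
  let B := Localization.AtPrime m
  have : IsDomain B := IsLocalization.isDomain_localization m.primeCompl_le_nonZeroDivisors
  have hdepth : 2 ≤ localDepth B := by
    have h1 := h.depth_eq_dim m
    rw [IsLocalization.AtPrime.ringKrullDim_eq_height m, WithBot.coe_inj] at h1
    exact h1 ▸ D.two_le_height
  obtain ⟨f, hfm, g, hgm, hf, hg⟩ := exists_regular_pair_of_localDepth hdepth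
  let φ : AddMonoidAlgebra K M →+* B := algebraMap _ _
  have hinj : Function.Injective φ :=
    IsLocalization.injective _ m.primeCompl_le_nonZeroDivisors
  let X (s : M) : AddMonoidAlgebra K M := AddMonoidAlgebra.single s 1
  have hXadd (s t : M) : X (s + t) = X s * X t := by
    simp [X, AddMonoidAlgebra.single_mul_single]
  have hXpow (n : ℕ) (s : M) : X (n • s) = X s ^ n := by
    simp [X, AddMonoidAlgebra.single_pow]
  have hX0 (s : M) : X s ≠ 0 := AddMonoidAlgebra.single_ne_zero.2 one_ne_zero
  let J : Ideal B := (Ideal.span {φ (X a₂)}).colon {φ (X a)}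
  have hJ (r : B) : r ∈ J ↔ φ (X a₂) ∣ r * φ (X a) := by
    rw [Submodule.mem_colon_singleton, smul_eq_mul, Ideal.mem_span_singleton]
  have hJ1 : φ (X a₁) ∈ J := (hJ _).2 ⟨φ (X b), by
    rw [← map_mul, ← map_mul, ← hXadd, ← hXadd, add_comm, hab, add_comm]⟩
  have hJ2 : φ (X a₂) ∈ J := (hJ _).2 (dvd_mul_right _ _)
  -- For `s ≠ 0` the `N`-th power of `X^s` is a nontrivial monomial in `X^a₁`, `X^a₂`, and both of
  -- these lie in `J`.
  have hrad : IsLocalRing.maximalIdeal B ≤ J.radical := by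
    rw [← Localization.AtPrime.map_eq_maximalIdeal, Ideal.map_le_iff_le_comap]
    refine D.ker_augmentation_le _ fun s hs => ⟨D.N, ?_⟩
    change (φ (X s)) ^ D.N ∈ J
    rw [← map_pow, ← hXpow, D.nsmul_eq, hXadd, hXpow, hXpow, map_mul, map_pow, map_pow]
    by_cases hu : D.u s = 0
    · have hv : D.v s ≠ 0 := fun hv => hs (D.eq_zero s hu hv)
      exact J.mul_mem_left _ (J.pow_mem_of_mem hJ2 _ (Nat.pos_of_ne_zero hv))
    · exact J.mul_mem_right _ (J.pow_mem_of_mem hJ1 _ (Nat.pos_of_ne_zero hu))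
  obtain ⟨p, hp⟩ := hrad hfm
  obtain ⟨q, hq⟩ := hrad hgm
  have hdvd : φ (X a) ∈ (Ideal.span {X a₂}).map φ := by
    rw [Ideal.map_span, Set.image_singleton, Ideal.mem_span_singleton]
    exact dvd_of_dvd_pow_mul hf hg ((map_ne_zero_iff φ hinj).2 (hX0 _)) p q
      ((hJ _).1 hp) ((hJ _).1 hq)
  obtain ⟨t, ht, hta⟩ := (IsLocalization.algebraMap_mem_map_algebraMap_iff m.primeCompl B _ _).1 hdvd
  obtain ⟨r, hr⟩ := Ideal.mem_span_singleton.1 hta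
  by_contra! hcon
  -- In `t * X^a = X^a₂ * r`, the coefficient at `a` is the constant term of `t` on the left. If
  -- `a₂` could not be subtracted from `a`, it would be zero on the right, putting `t` in `m`.
  have hc := congrArg (fun x => x.coeff a) hr
  simp only [X] at hc
  rw [mul_comm (AddMonoidAlgebra.single a₂ 1) r,
    AddMonoidAlgebra.coeff_mul_single_of_forall_add_ne _ _ fun d hd => hcon d hd.symm,
    AddMonoidAlgebra.coeff_mul_single_eq_coeff_mul 0 fun m' _ => by simp, mul_one] at hc
  exact ht (by rw [hm, SetLike.mem_coe, RingHom.mem_ker, D.augmentation_eq_coeff, hc])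

end

/-! ### Counting classes modulo the lattice of `a₁` and `a₂` -/

namespace PlaneSemigroup

/-- The determinant of two vectors of `ℕ²`. -/
def det (a b : ℕ × ℕ) : ℤ := (a.1 : ℤ) * (b.2 : ℤ) - (b.1 : ℤ) * (a.2 : ℤ)

/-- The linear endomorphism of `ℤ²` sending the standard basis to `a₁`, `a₂`. -/
noncomputable def latticeMap (a₁ a₂ : ℕ × ℕ) : ℤ × ℤ →ₗ[ℤ] ℤ × ℤ :=
  Matrix.toLin (Module.Basis.finTwoProd ℤ) (Module.Basis.finTwoProd ℤ)
    !![(a₁.1 : ℤ), (a₂.1 : ℤ); (a₁.2 : ℤ), (a₂.2 : ℤ)]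

theorem latticeMap_apply (a₁ a₂ : ℕ × ℕ) (x : ℤ × ℤ) :
    latticeMap a₁ a₂ x = x.1 • toInt a₁ + x.2 • toInt a₂ := by
  rw [latticeMap, Matrix.toLin_finTwoProd_apply]
  ext <;> simp [toInt, mul_comm]

/-- The quotient of `ℤ²` by the sublattice spanned by `a₁`, `a₂`. -/
abbrev LatticeQuotient (a₁ a₂ : ℕ × ℕ) : Type := (ℤ × ℤ) ⧸ LinearMap.range (latticeMap a₁ a₂)

/-- The residue class of a vector of `ℕ²` modulo the sublattice spanned by `a₁`, `a₂`. -/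
noncomputable def residue (a₁ a₂ z : ℕ × ℕ) : LatticeQuotient a₁ a₂ := Submodule.Quotient.mk (toInt z)

theorem residue_eq_mk_iff {a₁ a₂ z : ℕ × ℕ} {y : ℤ × ℤ} :
    residue a₁ a₂ z = Submodule.Quotient.mk y ↔
      ∃ i j : ℤ, toInt z = y + (i • toInt a₁ + j • toInt a₂) := by
  rw [residue, Submodule.Quotient.eq, LinearMap.mem_range]
  simp only [latticeMap_apply, Prod.exists, eq_sub_iff_add_eq, add_comm y]
  exact exists₂_congr fun _ _ => eq_comm

theorem residue_eq_iff {a₁ a₂ z z' : ℕ × ℕ} :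
    residue a₁ a₂ z = residue a₁ a₂ z' ↔
      ∃ i j : ℤ, toInt z = toInt z' + (i • toInt a₁ + j • toInt a₂) :=
  residue_eq_mk_iff

theorem toInt_injective : Function.Injective toInt := fun a b h => by
  simp only [toInt, Prod.mk.injEq, Nat.cast_inj] at h
  exact Prod.ext h.1 h.2

theorem toInt_add (a b : ℕ × ℕ) : toInt (a + b) = toInt a + toInt b := by
  ext <;> simp [toInt]

theorem toInt_nsmul (n : ℕ) (a : ℕ × ℕ) : toInt (n • a) = (n : ℤ) • toInt a := by
  ext <;> simp [toInt]

theorem card_latticeQuotient {a₁ a₂ : ℕ × ℕ} (h : det a₁ a₂ ≠ 0) :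
    ENat.card (LatticeQuotient a₁ a₂) = ((det a₁ a₂).natAbs : ℕ∞) := by
  have hdet : LinearMap.det (latticeMap a₁ a₂) = det a₁ a₂ := by
    rw [latticeMap, LinearMap.det_toLin, Matrix.det_fin_two_of, det]
  have hinj : Function.Injective (latticeMap a₁ a₂) := by
    rw [← LinearMap.ker_eq_bot]
    by_contra hker
    exact h (hdet ▸ LinearMap.det_eq_zero_iff_ker_ne_bot.2 hker)
  have hcard := Submodule.natAbs_det_equiv (LinearMap.range (latticeMap a₁ a₂))
    (LinearEquiv.ofInjective _ hinj)
  have hcomp : (LinearMap.range (latticeMap a₁ a₂)).subtype ∘ₗ AddMonoidHom.toIntLinearMap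
      ((LinearEquiv.ofInjective _ hinj : _ ≃ₗ[ℤ] _) :
        ℤ × ℤ →+ LinearMap.range (latticeMap a₁ a₂)) = latticeMap a₁ a₂ := by
    refine LinearMap.ext fun x => ?_
    rfl
  rw [hcomp, hdet] at hcard
  have : Finite (LatticeQuotient a₁ a₂) := Nat.finite_of_card_ne_zero (by
    rw [← hcard]; simpa using h)
  rw [hcard, ENat.card_eq_coe_natCard]

theorem injOn_residue_parallelogram {a₁ a₂ : ℕ × ℕ} (h : det a₁ a₂ ≠ 0) :
    Set.InjOn (residue a₁ a₂) (parallelogram a₁ a₂) := by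
  rintro z ⟨l₁, l₂, ⟨h1, h1'⟩, ⟨h2, h2'⟩, e⟩ z' ⟨m₁, m₂, ⟨k1, k1'⟩, ⟨k2, k2'⟩, e'⟩ hz
  obtain ⟨i, j, hij⟩ := residue_eq_iff.1 hz
  have hd : (a₁.1 : ℝ) * a₂.2 - a₂.1 * a₁.2 ≠ 0 := by
    rw [det] at h; exact_mod_cast h
  simp only [toReal, Prod.smul_mk, smul_eq_mul, Prod.mk_add_mk, Prod.mk.injEq] at e e'
  have q1 : (z.1 : ℝ) = z'.1 + (i * a₁.1 + j * a₂.1) := by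
    have := congrArg Prod.fst hij
    simp only [toInt, Prod.fst_add, Prod.smul_fst, smul_eq_mul] at this
    exact_mod_cast this
  have q2 : (z.2 : ℝ) = z'.2 + (i * a₁.2 + j * a₂.2) := by
    have := congrArg Prod.snd hij
    simp only [toInt, Prod.snd_add, Prod.smul_snd, smul_eq_mul] at this
    exact_mod_cast this
  have r1 : l₁ - m₁ = i := by
    apply mul_right_cancel₀ hd
    linear_combination (-a₂.2 : ℝ) * e.1 + a₂.2 * e'.1 + a₂.1 * e.2 - a₂.1 * e'.2 + a₂.2 * q1
      - a₂.1 * q2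
  have r2 : l₂ - m₂ = j := by
    apply mul_right_cancel₀ hd
    linear_combination (a₁.2 : ℝ) * e.1 - a₁.2 * e'.1 - a₁.1 * e.2 + a₁.1 * e'.2 - a₁.2 * q1
      + a₁.1 * q2
  have i0 : i = 0 := by
    have u1 : (i : ℝ) < 1 := by linarith
    have u2 : (-1 : ℝ) < i := by linarith
    have u1' : i < 1 := by exact_mod_cast u1
    have u2' : -1 < i := by exact_mod_cast u2
    omega
  have j0 : j = 0 := by
    have u1 : (j : ℝ) < 1 := by linarith
    have u2 : (-1 : ℝ) < j := by linarith
    have u1' : j < 1 := by exact_mod_cast u1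
    have u2' : -1 < j := by exact_mod_cast u2
    omega
  exact toInt_injective (by rw [hij, i0, j0]; simp)

theorem exists_mem_parallelogram_residue_eq {a₁ a₂ : ℕ × ℕ} (h : det a₁ a₂ ≠ 0)
    (q : LatticeQuotient a₁ a₂) : ∃ z ∈ parallelogram a₁ a₂, residue a₁ a₂ z = q := by
  obtain ⟨⟨x, y⟩, rfl⟩ := Submodule.Quotient.mk_surjective _ q
  have hd : (a₁.1 : ℝ) * a₂.2 - a₂.1 * a₁.2 ≠ 0 := by
    rw [det] at h; exact_mod_cast h
  set D : ℝ := (a₁.1 : ℝ) * a₂.2 - a₂.1 * a₁.2 with hD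
  set l₁ : ℝ := (x * a₂.2 - a₂.1 * y) / D with hl₁
  set l₂ : ℝ := (a₁.1 * y - x * a₁.2) / D with hl₂
  have ex : (x : ℝ) = l₁ * a₁.1 + l₂ * a₂.1 := by
    rw [hl₁, hl₂]; field_simp; rw [hD]; ring
  have ey : (y : ℝ) = l₁ * a₁.2 + l₂ * a₂.2 := by
    rw [hl₁, hl₂]; field_simp; rw [hD]; ring
  have fx : ((x - (⌊l₁⌋ * a₁.1 + ⌊l₂⌋ * a₂.1) : ℤ) : ℝ) =
      Int.fract l₁ * a₁.1 + Int.fract l₂ * a₂.1 := by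
    push_cast; rw [ex, Int.fract, Int.fract]; ring
  have fy : ((y - (⌊l₁⌋ * a₁.2 + ⌊l₂⌋ * a₂.2) : ℤ) : ℝ) =
      Int.fract l₁ * a₁.2 + Int.fract l₂ * a₂.2 := by
    push_cast; rw [ey, Int.fract, Int.fract]; ring
  -- Fractional parts are nonnegative and `a₁`, `a₂` lie in `ℕ²`, so the reduced point lies in `ℕ²`
  -- too.
  have n1 := Int.fract_nonneg l₁
  have n2 := Int.fract_nonneg l₂
  have px : 0 ≤ x - (⌊l₁⌋ * a₁.1 + ⌊l₂⌋ * a₂.1) := by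
    have : (0 : ℝ) ≤ ((x - (⌊l₁⌋ * a₁.1 + ⌊l₂⌋ * a₂.1) : ℤ) : ℝ) := by rw [fx]; positivity
    exact_mod_cast this
  have py : 0 ≤ y - (⌊l₁⌋ * a₁.2 + ⌊l₂⌋ * a₂.2) := by
    have : (0 : ℝ) ≤ ((y - (⌊l₁⌋ * a₁.2 + ⌊l₂⌋ * a₂.2) : ℤ) : ℝ) := by rw [fy]; positivity
    exact_mod_cast this
  obtain ⟨X, hX⟩ := Int.eq_ofNat_of_zero_le px
  obtain ⟨Y, hY⟩ := Int.eq_ofNat_of_zero_le py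
  refine ⟨(X, Y), ⟨Int.fract l₁, Int.fract l₂, ⟨n1, Int.fract_lt_one _⟩,
    ⟨n2, Int.fract_lt_one _⟩, ?_⟩, residue_eq_mk_iff.2 ⟨-⌊l₁⌋, -⌊l₂⌋, ?_⟩⟩
  · rw [hX] at fx
    rw [hY] at fy
    ext
    · simpa [toReal] using fx
    · simpa [toReal] using fy
  · ext
    · simp only [toInt, Prod.fst_add, Prod.smul_fst, smul_eq_mul, ← hX]; ring
    · simp only [toInt, Prod.snd_add, Prod.smul_snd, smul_eq_mul, ← hY]; ring

section Submonoid

variable {S : AddSubmonoid (ℕ × ℕ)} {a₁ a₂ : S}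

theorem coe_mem_aperySet_iff (w : S) :
    (w : ℕ × ℕ) ∈ aperySet S {(a₁ : ℕ × ℕ), (a₂ : ℕ × ℕ)} ↔ w ∈ aperyElements a₁ a₂ := by
  have key (a : S) : toInt w - toInt a ∉ toInt '' (S : Set (ℕ × ℕ)) ↔ ∀ c, w ≠ c + a := by
    constructor
    · rintro h c rfl
      exact h ⟨c, c.2, by rw [AddSubmonoid.coe_add, toInt_add, add_sub_cancel_right]⟩
    · rintro h ⟨c, hc, e⟩
      refine h ⟨c, hc⟩ (Subtype.ext (toInt_injective ?_))
      rw [AddSubmonoid.coe_add, toInt_add, e, sub_add_cancel]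
  simp only [aperySet, aperyElements, Set.mem_ofPred_eq, SetLike.coe_mem, true_and,
    Set.mem_insert_iff, Set.mem_singleton_iff, forall_eq_or_imp, forall_eq, key]

theorem residue_eq_iff_exists_nat {w w' : S} :
    residue a₁ a₂ w = residue a₁ a₂ w' ↔
      ∃ i j i' j' : ℕ, w + i • a₁ + j • a₂ = w' + i' • a₁ + j' • a₂ := by
  rw [residue_eq_iff]
  have coe (w : S) (i j : ℕ) : toInt ((w + i • a₁ + j • a₂ : S) : ℕ × ℕ) =
      toInt w + (i : ℤ) • toInt a₁ + (j : ℤ) • toInt a₂ := by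
    simp only [AddSubmonoid.coe_add, AddSubmonoidClass.coe_nsmul, toInt_add, toInt_nsmul]
  constructor
  · rintro ⟨i, j, h⟩
    refine ⟨(-i).toNat, (-j).toNat, i.toNat, j.toNat, Subtype.ext (toInt_injective ?_)⟩
    rw [coe, coe, h]
    have hi : (i : ℤ) = (i.toNat : ℤ) - ((-i).toNat : ℤ) := by omega
    have hj : (j : ℤ) = (j.toNat : ℤ) - ((-j).toNat : ℤ) := by omega
    nth_rewrite 1 [hi, hj]
    module
  · rintro ⟨i, j, i', j', h⟩
    refine ⟨i' - i, j' - j, ?_⟩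
    have := congrArg (fun s : S => toInt s) h
    simp only [coe] at this
    have e : toInt w = (toInt w + (i : ℤ) • toInt a₁ + (j : ℤ) • toInt a₂) -
      ((i : ℤ) • toInt a₁ + (j : ℤ) • toInt a₂) := by abel
    rw [e, this]
    module

theorem mem_groupOfDifferences_iff (D : SimplicialWeights a₁ a₂) (z : ℕ × ℕ) :
    toInt z ∈ groupOfDifferences S ↔ residue (a₁ : ℕ × ℕ) a₂ z ∈
      residue (a₁ : ℕ × ℕ) a₂ '' aperySet S {(a₁ : ℕ × ℕ), (a₂ : ℕ × ℕ)} := by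
  constructor
  · rintro ⟨a, ha, b, hb, hz⟩
    obtain ⟨n, hn⟩ := Nat.exists_eq_add_of_lt D.N_pos
    -- Here `n = N - 1`. As `N • b` lies in the lattice, `a - b` is congruent to `a + (N - 1) • b`,
    -- an element of `S`.
    obtain ⟨w, hw, i, j, hs⟩ := D.exists_decomposition (⟨a, ha⟩ + n • ⟨b, hb⟩)
    refine ⟨w, (coe_mem_aperySet_iff w).2 hw, residue_eq_iff.2
      ⟨(D.u ⟨b, hb⟩ : ℤ) - i, (D.v ⟨b, hb⟩ : ℤ) - j, ?_⟩⟩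
    have h1 := congrArg (fun s : S => toInt s) hs
    have h2 := congrArg (fun s : S => toInt s) (D.nsmul_eq ⟨b, hb⟩)
    simp only [AddSubmonoid.coe_add, AddSubmonoidClass.coe_nsmul, toInt_add, toInt_nsmul, hn] at h1 h2
    push_cast at h2
    rw [hz]
    simp only [zero_add, add_smul, one_smul] at h2
    calc toInt w = (toInt w + (i : ℤ) • toInt a₁ + (j : ℤ) • toInt a₂) -
          ((i : ℤ) • toInt a₁ + (j : ℤ) • toInt a₂) := by abel
      _ = toInt a - toInt b + (((n : ℤ) • toInt b + toInt b) -
          ((i : ℤ) • toInt a₁ + (j : ℤ) • toInt a₂)) := by rw [← h1]; abel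
      _ = _ := by rw [h2]; module
  · rintro ⟨w, hw, e⟩
    obtain ⟨i, j, h⟩ := residue_eq_iff.1 e.symm
    refine ⟨w + i.toNat • a₁ + j.toNat • a₂, ?_, (-i).toNat • a₁ + (-j).toNat • a₂, ?_, ?_⟩
    · exact add_mem (add_mem hw.1 (nsmul_mem a₁.2 _)) (nsmul_mem a₂.2 _)
    · exact add_mem (nsmul_mem a₁.2 _) (nsmul_mem a₂.2 _)
    · simp only [toInt_add, toInt_nsmul, h]
      have hi : (i : ℤ) = (i.toNat : ℤ) - ((-i).toNat : ℤ) := by omega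
      have hj : (j : ℤ) = (j.toNat : ℤ) - ((-j).toNat : ℤ) := by omega
      nth_rewrite 1 [hi, hj]
      module

theorem injOn_residue_aperySet_iff (D : SimplicialWeights a₁ a₂) :
    Set.InjOn (residue (a₁ : ℕ × ℕ) a₂) (aperySet S {(a₁ : ℕ × ℕ), (a₂ : ℕ × ℕ)}) ↔
      RegularPair a₁ a₂ := by
  rw [D.regularPair_iff]
  constructor
  · intro h w hw w' hw' i j i' j' e
    exact Subtype.ext (h ((coe_mem_aperySet_iff w).2 hw) ((coe_mem_aperySet_iff w').2 hw')
      (residue_eq_iff_exists_nat.2 ⟨i, j, i', j', e⟩))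
  · intro h w hw w' hw' e
    obtain ⟨i, j, i', j', e'⟩ :=
      residue_eq_iff_exists_nat (w := ⟨w, hw.1⟩) (w' := ⟨w', hw'.1⟩) |>.1 e
    exact congrArg Subtype.val (h ⟨w, hw.1⟩ ((coe_mem_aperySet_iff _).1 hw) ⟨w', hw'.1⟩
      ((coe_mem_aperySet_iff _).1 hw') i j i' j' e')

theorem encard_add_encard_eq_iff (D : SimplicialWeights a₁ a₂)
    (hdet : det (a₁ : ℕ × ℕ) a₂ ≠ 0) :
    (aperySet S {(a₁ : ℕ × ℕ), (a₂ : ℕ × ℕ)}).encard +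
        (parallelogram (a₁ : ℕ × ℕ) a₂ \ toInt ⁻¹' groupOfDifferences S).encard =
      ((det (a₁ : ℕ × ℕ) a₂).natAbs : ℕ∞) ↔ RegularPair a₁ a₂ := by
  rw [← injOn_residue_aperySet_iff D, ← card_latticeQuotient hdet]
  set A := aperySet S {(a₁ : ℕ × ℕ), (a₂ : ℕ × ℕ)}
  set π := residue (a₁ : ℕ × ℕ) a₂
  set P := parallelogram (a₁ : ℕ × ℕ) a₂
  have himage : π '' (P \ toInt ⁻¹' groupOfDifferences S) = (π '' A)ᶜ := by
    ext q
    constructor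
    · rintro ⟨z, ⟨-, hz⟩, rfl⟩
      exact fun h => hz ((mem_groupOfDifferences_iff D z).2 h)
    · intro hq
      obtain ⟨z, hz, rfl⟩ := exists_mem_parallelogram_residue_eq hdet q
      exact ⟨z, ⟨hz, fun h => hq ((mem_groupOfDifferences_iff D z).1 h)⟩, rfl⟩
  rw [← ((injOn_residue_parallelogram hdet).mono Set.sdiff_subset).encard_image, himage,
    ← Set.encard_univ, ← Set.encard_add_encard_compl (π '' A)]
  have : Finite (LatticeQuotient (a₁ : ℕ × ℕ) a₂) := by
    rw [← ENat.card_lt_top, card_latticeQuotient hdet]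
    exact ENat.natCast_lt_top _
  -- Cancelling the finite complement of `π '' A` leaves the equality of the cardinalities of `A`
  -- and `π '' A`, which also forces `A` to be finite.
  rw [ENat.add_left_injective_of_ne_top (Set.encard_ne_top_iff.2 (Set.toFinite _)) |>.eq_iff]
  refine ⟨fun h => ?_, fun h => h.encard_image.symm⟩
  have hfin : A.Finite := by
    rw [← Set.encard_ne_top_iff, h, Set.encard_ne_top_iff]
    exact Set.toFinite _
  exact hfin.injOn_of_encard_image_eq h.symm

end Submonoid

end PlaneSemigroup

/-! ### Semigroup ring as monoid algebra -/

namespace PlaneSemigroup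

section SemigroupRing

variable (K : Type*) [Field K] (S : AddSubmonoid (ℕ × ℕ))

/-- The inclusion of `S` into the exponents of monomials in two variables. -/
noncomputable def exponent : S →+ (Fin 2 →₀ ℕ) where
  toFun s := Finsupp.single 0 s.1.1 + Finsupp.single 1 s.1.2
  map_zero' := by simp
  map_add' s t := by simp only [AddSubmonoid.coe_add, Prod.fst_add, Prod.snd_add,
    Finsupp.single_add]; abel

theorem exponent_injective : Function.Injective (exponent S) := by
  intro s t h
  have h0 := DFunLike.congr_fun h 0
  have h1 := DFunLike.congr_fun h 1
  simp [exponent] at h0 h1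
  exact Subtype.ext (Prod.ext h0 h1)

/-- The embedding of the monoid algebra of `S` into the polynomial ring. -/
noncomputable def toMvPolynomial : AddMonoidAlgebra K S →ₐ[K] MvPolynomial (Fin 2) K :=
  AddMonoidAlgebra.mapDomainAlgHom K K (exponent S)

theorem toMvPolynomial_injective : Function.Injective (toMvPolynomial K S) :=
  AddMonoidAlgebra.mapDomain_injective (exponent_injective S)

theorem toMvPolynomial_single (s : S) : toMvPolynomial K S (AddMonoidAlgebra.single s 1) =
    MvPolynomial.X 0 ^ s.1.1 * MvPolynomial.X 1 ^ s.1.2 := by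
  rw [MvPolynomial.X_pow_eq_monomial, MvPolynomial.X_pow_eq_monomial, MvPolynomial.monomial_mul,
    one_mul]
  exact AddMonoidAlgebra.mapDomain_single

theorem range_toMvPolynomial : (toMvPolynomial K S).range = semigroupRing K S := by
  apply le_antisymm
  · rintro _ ⟨x, rfl⟩
    change toMvPolynomial K S x ∈ _
    induction x using AddMonoidAlgebra.induction_linear with
    | zero => rw [map_zero]; exact zero_mem _
    | add x y hx hy => rw [map_add]; exact add_mem hx hy
    | single s c =>
      have : AddMonoidAlgebra.single s c = c • AddMonoidAlgebra.single s (1 : K) := by simp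
      rw [this, map_smul]
      refine Subalgebra.smul_mem _ (?_ : _ ∈ semigroupRing K S) c
      rw [toMvPolynomial_single]
      exact Algebra.subset_adjoin ⟨s, s.2, rfl⟩
  · refine Algebra.adjoin_le ?_
    rintro _ ⟨s, hs, rfl⟩
    exact ⟨AddMonoidAlgebra.single ⟨s, hs⟩ 1, toMvPolynomial_single K S ⟨s, hs⟩⟩

/-- The semigroup ring is the monoid algebra of `S`. -/
noncomputable def semigroupRingEquiv : AddMonoidAlgebra K S ≃ₐ[K] semigroupRing K S :=
  (AlgEquiv.ofInjective _ (toMvPolynomial_injective K S)).trans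
    (Subalgebra.equivOfEq _ _ (range_toMvPolynomial K S))

end SemigroupRing

/-! ### Coordinates with respect to the extremal rays -/

variable {S : AddSubmonoid (ℕ × ℕ)} {a₁ a₂ : ℕ × ℕ}

theorem mem_hull_singleton_iff {x y : ℝ × ℝ} :
    y ∈ PointedCone.hull ℝ {x} ↔ ∃ t : ℝ, 0 ≤ t ∧ t • x = y := by
  rw [PointedCone.hull, Submodule.mem_span_singleton]
  exact ⟨fun ⟨t, h⟩ => ⟨t, t.2, h⟩, fun ⟨t, ht, h⟩ => ⟨⟨t, ht⟩, h⟩⟩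

theorem det_eq_zero_of_mem_hull {a b : ℕ × ℕ}
    (h : toReal b ∈ PointedCone.hull ℝ {toReal a}) : det a b = 0 := by
  obtain ⟨t, -, ht⟩ := mem_hull_singleton_iff.1 h
  simp only [toReal, Prod.smul_mk, smul_eq_mul, Prod.mk.injEq] at ht
  have : ((a.1 : ℝ) * b.2 - b.1 * a.2) = 0 := by rw [← ht.1, ← ht.2]; ring
  rw [det]
  exact_mod_cast this

theorem mem_hull_of_det_eq_zero {a b : ℕ × ℕ} (ha : a ≠ 0) (h : det a b = 0) :
    toReal b ∈ PointedCone.hull ℝ {toReal a} := by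
  have h' : ((a.1 : ℝ) * b.2 - b.1 * a.2) = 0 := by rw [det] at h; exact_mod_cast h
  rw [mem_hull_singleton_iff]
  by_cases h1 : a.1 = 0
  · have h2 : a.2 ≠ 0 := fun h2 => ha (Prod.ext h1 h2)
    have h2' : (a.2 : ℝ) ≠ 0 := by exact_mod_cast h2
    refine ⟨b.2 / a.2, by positivity, ?_⟩
    have hb : (b.1 : ℝ) = 0 := by simpa [h1, h2'] using h'
    ext <;> simp [toReal, h1, hb, h2']
  · have h1' : (a.1 : ℝ) ≠ 0 := by exact_mod_cast h1
    refine ⟨b.1 / a.1, by positivity, ?_⟩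
    ext
    · simp [toReal, h1']
    · simp only [toReal, Prod.smul_mk, smul_eq_mul]
      field_simp
      linarith

theorem IsExtremalRay.det_ne_zero (h₁ : IsExtremalRay S a₁) (h₂ : IsExtremalRay S a₂)
    (h₁₂ : a₁ ≠ a₂) : det a₁ a₂ ≠ 0 := by
  intro h
  have h' : det a₂ a₁ = 0 := by rw [det] at h ⊢; linarith
  exact h₁₂ (le_antisymm
    (h₁.le_of_mem a₂ h₂.mem h₂.ne_zero (mem_hull_of_det_eq_zero h₁.ne_zero h))
    (h₂.le_of_mem a₁ h₁.mem h₁.ne_zero (mem_hull_of_det_eq_zero h₂.ne_zero h')))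

theorem toReal_mem_cone {s : ℕ × ℕ} (hs : s ∈ S) : toReal s ∈ cone S :=
  Submodule.subset_span ⟨s, hs, rfl⟩

theorem smul_mem_cone {x : ℝ × ℝ} (hx : x ∈ cone S) {t : ℝ} (ht : 0 ≤ t) : t • x ∈ cone S :=
  (cone S).smul_mem ht hx

theorem IsExtremalRay.det_mul_det_nonneg (h₁ : IsExtremalRay S a₁) (h₂ : IsExtremalRay S a₂)
    (h : det a₁ a₂ ≠ 0) {s : ℕ × ℕ} (hs : s ∈ S) : 0 ≤ det s a₂ * det a₁ a₂ := by
  have hd : (a₁.1 : ℝ) * a₂.2 - a₂.1 * a₁.2 ≠ 0 := by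
    rw [det] at h; exact_mod_cast h
  set D : ℝ := (a₁.1 : ℝ) * a₂.2 - a₂.1 * a₁.2 with hD
  set l₁ : ℝ := (s.1 * a₂.2 - a₂.1 * s.2) / D with hl₁
  set l₂ : ℝ := (a₁.1 * s.2 - s.1 * a₁.2) / D with hl₂
  have ex : (s.1 : ℝ) = l₁ * a₁.1 + l₂ * a₂.1 := by
    rw [hl₁, hl₂]; field_simp; rw [hD]; ring
  have ey : (s.2 : ℝ) = l₁ * a₁.2 + l₂ * a₂.2 := by
    rw [hl₁, hl₂]; field_simp; rw [hD]; ring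
  suffices 0 ≤ l₁ by
    have hprod : (0 : ℝ) ≤ (s.1 * a₂.2 - a₂.1 * s.2) * D := by
      have e : (s.1 * a₂.2 - a₂.1 * s.2) * D = l₁ * (D * D) := by rw [hl₁]; field_simp
      rw [e]
      exact mul_nonneg this (mul_self_nonneg D)
    rw [hD] at hprod
    rw [det, det]
    exact_mod_cast hprod
  by_contra! hneg
  refine h ?_
  have hface : toReal a₁ ∈ PointedCone.hull ℝ {toReal a₂} := by
    -- If `l₁ < 0`, then `-l₁ • a₁ + (s + |l₂| • a₂) = (l₂ + |l₂|) • a₂` lies on the face of `a₂`,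
    -- which forces `a₁` onto that ray. The term `|l₂| • a₂` keeps the coefficient nonnegative.
    refine h₂.isFaceOf.mem_of_smul_add_mem (x := toReal a₁) (y := toReal s + |l₂| • toReal a₂)
      (a := -l₁) (toReal_mem_cone h₁.mem)
      (add_mem (toReal_mem_cone hs) (smul_mem_cone (toReal_mem_cone h₂.mem) (abs_nonneg _)))
      (by linarith) (mem_hull_singleton_iff.2
        ⟨l₂ + |l₂|, by linarith [neg_abs_le l₂], ?_⟩)
    ext
    · simp only [toReal, Prod.smul_mk, Prod.mk_add_mk, smul_eq_mul]
      rw [ex]; ring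
    · simp only [toReal, Prod.smul_mk, Prod.mk_add_mk, smul_eq_mul]
      rw [ey]; ring
  have := det_eq_zero_of_mem_hull hface
  rw [det] at this ⊢
  linarith

/-- With a fixed sign, absolute values of determinants become linear, hence additive weights. -/
theorem natAbs_eq_sign_mul {x d : ℤ} (hd : d ≠ 0) (h : 0 ≤ x * d) :
    (x.natAbs : ℤ) = d.sign * x := by
  rcases lt_or_gt_of_ne hd with hd | hd
  · rw [Int.sign_eq_neg_one_of_neg hd, Int.ofNat_natAbs_of_nonpos (by nlinarith)]; ring
  · rw [Int.sign_eq_one_of_pos hd, Int.natAbs_of_nonneg (by nlinarith)]; ring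

/-- The coordinates with respect to the extremal rays. -/
def IsExtremalRay.weights (h₁ : IsExtremalRay S a₁) (h₂ : IsExtremalRay S a₂)
    (h : det a₁ a₂ ≠ 0) : SimplicialWeights (⟨a₁, h₁.mem⟩ : S) (⟨a₂, h₂.mem⟩ : S) :=
  have h' : det a₂ a₁ ≠ 0 := fun e => h (by rw [det] at e ⊢; linarith)
  have hu (s : S) := natAbs_eq_sign_mul h (h₁.det_mul_det_nonneg h₂ h s.2)
  have hv (s : S) : ((det a₁ s).natAbs : ℤ) = (det a₁ a₂).sign * det a₁ s :=
    natAbs_eq_sign_mul h (by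
      have := h₂.det_mul_det_nonneg h₁ h' s.2
      rw [det, det] at this ⊢
      linarith)
  have hN : ((det a₁ a₂).natAbs : ℤ) = (det a₁ a₂).sign * det a₁ a₂ :=
    natAbs_eq_sign_mul h (mul_self_nonneg _)
  -- Cramer's rule, multiplied by the common sign of the three determinants.
  have hsmul (s : S) : (det a₁ a₂).natAbs • s =
      (det s a₂).natAbs • (⟨a₁, h₁.mem⟩ : S) + (det a₁ s).natAbs • (⟨a₂, h₂.mem⟩ : S) := by
    refine Subtype.ext (toInt_injective ?_)
    simp only [AddSubmonoid.coe_add, AddSubmonoidClass.coe_nsmul, toInt_add, toInt_nsmul, hu, hv,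
      hN]
    ext <;> simp only [toInt, det, Prod.smul_mk, Prod.mk_add_mk, smul_eq_mul] <;> ring
  { N := (det a₁ a₂).natAbs
    u :=
      { toFun := fun s => (det s a₂).natAbs
        map_zero' := by simp [det]
        map_add' := fun s t => by
          apply Nat.cast_injective (R := ℤ)
          rw [Nat.cast_add, hu, hu, hu]
          simp only [det, AddSubmonoid.coe_add, Prod.fst_add, Prod.snd_add]
          push_cast
          ring }
    v :=
      { toFun := fun s => (det a₁ s).natAbs
        map_zero' := by simp [det]
        map_add' := fun s t => by
          apply Nat.cast_injective (R := ℤ)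
          rw [Nat.cast_add, hv, hv, hv]
          simp only [det, AddSubmonoid.coe_add, Prod.fst_add, Prod.snd_add]
          push_cast
          ring }
    N_pos := Int.natAbs_pos.2 h
    u_left := rfl
    u_right := by simp [det]
    v_left := by simp [det]
    v_right := rfl
    nsmul_eq := hsmul
    eq_zero := fun s hus hvs => by
      have e := hsmul s
      change (det s a₂).natAbs = 0 at hus
      change (det a₁ s).natAbs = 0 at hvs
      rw [hus, hvs, zero_nsmul, zero_nsmul, zero_add] at e
      have e' := congrArg Subtype.val e
      rw [AddSubmonoidClass.coe_nsmul] at e'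
      have hpos : (det a₁ a₂).natAbs ≠ 0 := Int.natAbs_ne_zero.2 h
      refine Subtype.ext (Prod.ext ?_ ?_)
      · have := congrArg Prod.fst e'
        simpa [h] using this
      · have := congrArg Prod.snd e'
        simpa [h] using this }

end PlaneSemigroup

theorem mainTheorem10 (K : Type*) [Field K] (S : AddSubmonoid (ℕ × ℕ)) (hS : S.FG)
    (a₁ a₂ : ℕ × ℕ) (h₁ : PlaneSemigroup.IsExtremalRay S a₁)
    (h₂ : PlaneSemigroup.IsExtremalRay S a₂) (h₁₂ : a₁ ≠ a₂) :
    IsCohenMacaulayRing (PlaneSemigroup.semigroupRing K S) ↔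
      (PlaneSemigroup.aperySet S {a₁, a₂}).encard +
          (PlaneSemigroup.parallelogram a₁ a₂ \
            PlaneSemigroup.toInt ⁻¹' PlaneSemigroup.groupOfDifferences S).encard =
        ((((a₁.1 : ℤ) * (a₂.2 : ℤ) - (a₂.1 : ℤ) * (a₁.2 : ℤ)).natAbs : ℕ) : ℕ∞) := by
  have hdet := h₁.det_ne_zero h₂ h₁₂
  have D := h₁.weights h₂ hdet
  have : IsDomain (AddMonoidAlgebra K S) :=
    (PlaneSemigroup.toMvPolynomial_injective K S).isDomain
      (PlaneSemigroup.toMvPolynomial K S).toRingHom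
  have : AddMonoid.FG S := (AddMonoid.fg_iff_addSubmonoid_fg S).2 hS
  have e := (PlaneSemigroup.semigroupRingEquiv K S).toRingEquiv
  refine Iff.trans ?_ (PlaneSemigroup.encard_add_encard_eq_iff D hdet).symm
  exact ⟨fun h => D.regularPair_of_isCohenMacaulayRing (K := K) (h.of_ringEquiv e.symm),
    fun h => (D.isCohenMacaulayRing (K := K) h).of_ringEquiv e⟩
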